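/- Let $\mathcal X$ be a standard Borel space, $\nu$ a probability measure on $\mathcal X$, and $\mathcal H$ a separable real reproducing kernel Hilbert space of functions on $\mathcal X$ with measurable kernel $K:\mathcal X\times\mathcal X\to\mathbb R$ satisfying $\sup_{x\in\mathcal X}K(x,x)\le\kappa^2$ for some $\kappa>0$. Define bounded operators on $\mathcal H$ by \[ Bf=\int_{\mathcal X} f(x)\,K(x,\cdot)\,d\nu(x),\qquad B_{\mathbf x}f=\frac1n\sum_{j=1}^n f(x_j)\,K(x_j,\cdot)\quad(\mathbf x=(x_1,\dots,x_n)\in\mathcal X^n), \] put $\bar B=\kappa^{-2}B$, $\bar B_{\mathbf x}=\kappa^{-2}B_{\mathbf x}$, and for $\lambda\in(0,1]$ define the effective dimension and the empirical effective dimension by \[ \mathcal N(\lambda)=\operatorname{tr}\big((\bar B+\lambda)^{-1}\bar B\big),\qquad \mathcal N_{\mathbf x}(\lambda)=\operatorname{tr}\big((\bar B_{\mathbf x}+\lambda)^{-1}\bar B_{\mathbf x}\big); \] the inverses exist and the operators are trace class. Let $n\ge1$, $\lambda\in(0,1]$, $\eta\in(0,1)$, and let $\mathbf x=(x_1,\dots,x_n)$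 be drawn i.i.d. from $\nu$. Set $\delta=2\log(4\eta^{-1})/\sqrt{n\lambda}$. Then with probability at least $1-\eta$ both \[ \sqrt{\max(\mathcal N(\lambda),1)}\le(1+4\delta)\sqrt{\max(\mathcal N_{\mathbf x}(\lambda),1)} \] and \[ \sqrt{\max(\mathcal N_{\mathbf x}(\lambda),1)}\le\big(1+4\max(\sqrt\delta,\delta^2)\big)\sqrt{\max(\mathcal N(\lambda),1)} \] hold. In particular, if $\delta\le1$, then with probability at least $1-\eta$ \[ \tfrac15\sqrt{\max(\mathcal N(\lambda),1)}\le\sqrt{\max(\mathcal N_{\mathbf x}(\lambda),1)}\le5\sqrt{\max(\mathcal N(\lambda),1)}. \] -/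

import Mathlib

open MeasureTheory ProbabilityTheory
open scoped InnerProductSpace

noncomputable section

namespace EffDim

section Trace

variable {H : Type*} [NormedAddCommGroup H] [InnerProductSpace ℝ H] [CompleteSpace H]

/-- `T` is trace class: its modulus `A = |T|`, i.e. the positive operator with `A² = T* T`, has
finite trace `∑ i, ⟪b i, A (b i)⟫` in every Hilbert basis `b`. -/
def IsTraceClass (T : H →L[ℝ] H) : Prop :=
  ∃ A : H →L[ℝ] H, A.IsPositive ∧ A ∘L A = ContinuousLinearMap.adjoint T ∘L T ∧
    ∀ (w : Set H) (b : HilbertBasis w ℝ H), Summable fun i => ⟪b i, A (b i)⟫_ℝ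

variable (H) in
/-- The index set of a fixed Hilbert basis of `H`. -/
def basisSet : Set H := (exists_hilbertBasis ℝ H).choose

variable (H) in
/-- A fixed Hilbert basis of `H`. -/
def basis : HilbertBasis (basisSet H) ℝ H := (exists_hilbertBasis ℝ H).choose_spec.choose

/-- The trace `∑ i, ⟪b i, T (b i)⟫` of a trace class operator, in a Hilbert basis `b`
(it does not depend on the basis). -/
def trace (T : H →L[ℝ] H) : ℝ := ∑' i, ⟪basis H i, T (basis H i)⟫_ℝ

/-- The operator `(T + lam)⁻¹ T`; the inverse is the one of the algebra of bounded operators. -/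
def resolventMul (T : H →L[ℝ] H) (lam : ℝ) : H →L[ℝ] H :=
  Ring.inverse (T + lam • (1 : H →L[ℝ] H)) * T

/-- `tr ((T + lam)⁻¹ T)`. -/
def effDim (T : H →L[ℝ] H) (lam : ℝ) : ℝ := trace (resolventMul T lam)

end Trace

section Kernel

variable {X : Type*} (H : Type*) [NormedAddCommGroup H] [InnerProductSpace ℝ H] [CompleteSpace H]
  [RKHS ℝ H X ℝ]

/-- The real-valued reproducing kernel `K(x, y)` of `H`. -/
def K (x y : X) : ℝ := RKHS.kernel H x y (1 : ℝ)

/-- The kernel section `K(x, ·)` as an element of `H`. -/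
def kSec (x : X) : H := RKHS.kerFun H x (1 : ℝ)

/-- The rank-one operator `f ↦ f(x) K(x, ·)`. -/
def kOp (x : X) : H →L[ℝ] H := InnerProductSpace.rankOne ℝ (kSec H x) (kSec H x)

/-- The kernel integral operator `B : f ↦ ∫ f(x) K(x, ·) dν(x)`
(see `covOp_apply` for the pointwise formula). -/
def covOp [MeasurableSpace X] (ν : Measure X) : H →L[ℝ] H := ∫ x, kOp H x ∂ν

/-- The empirical operator `B_x : f ↦ (1/n) ∑ j, f(x_j) K(x_j, ·)`. -/
def empOp {n : ℕ} (x : Fin n → X) : H →L[ℝ] H := (n : ℝ)⁻¹ • ∑ j, kOp H (x j)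

/-- The effective dimension `N(lam) = tr ((κ⁻² B + lam)⁻¹ κ⁻² B)`. -/
def popDim [MeasurableSpace X] (κ : ℝ) (ν : Measure X) (lam : ℝ) : ℝ :=
  effDim ((κ ^ 2)⁻¹ • covOp H ν) lam

/-- The empirical effective dimension `N_x(lam) = tr ((κ⁻² B_x + lam)⁻¹ κ⁻² B_x)`. -/
def empDim {n : ℕ} (κ : ℝ) (x : Fin n → X) (lam : ℝ) : ℝ :=
  effDim ((κ ^ 2)⁻¹ • empOp H x) lam

variable {H}

theorem inner_kSec (x : X) (f : H) : ⟪kSec H x, f⟫_ℝ = f x := by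
  simp [kSec]

theorem kSec_apply (x y : X) : kSec H y x = K H x y := by
  simp [kSec, K, RKHS.kerFun_apply]

theorem kOp_apply (x : X) (f : H) : kOp H x f = f x • kSec H x := by
  simp [kOp, InnerProductSpace.rankOne_apply, inner_kSec]

theorem empOp_apply {n : ℕ} (x : Fin n → X) (f : H) :
    empOp H x f = (n : ℝ)⁻¹ • ∑ j, f (x j) • kSec H (x j) := by
  simp [empOp, kOp_apply]

theorem norm_kSec_sq (x : X) : ‖kSec H x‖ ^ 2 = K H x x := by
  rw [← real_inner_self_eq_norm_sq, inner_kSec, kSec_apply]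

variable [MeasurableSpace X]

theorem measurable_coe (hK : Measurable fun p : X × X => K H p.1 p.2) (f : H) :
    Measurable fun x => f x := by
  have hf : f ∈ closure (Submodule.span ℝ {RKHS.kerFun H x v | (x : X) (v : ℝ)} : Set H) := by
    have := RKHS.kerFun_dense (𝕜 := ℝ) (X := X) (V := ℝ) H
    rw [← Submodule.topologicalClosure_coe, this]; trivial
  obtain ⟨u, hu, hlim⟩ := mem_closure_iff_seq_limit.1 hf
  refine measurable_of_tendsto_metrizable (f := fun n x => u n x) (fun n => ?_)
    (tendsto_pi_nhds.2 fun x => ((RKHS.continuous_eval (𝕜 := ℝ) x).tendsto f).comp hlim)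
  refine Submodule.span_induction (p := fun g _ => Measurable fun x => (g : H) x)
    ?_ ?_ ?_ ?_ (hu n)
  · rintro _ ⟨y, v, rfl⟩
    have h : (fun x => RKHS.kerFun H y v x) = fun x => v * K H x y := by
      funext x
      rw [RKHS.kerFun_apply, K, ← smul_eq_mul, ← map_smul, smul_eq_mul, mul_one]
    rw [h]
    exact (hK.comp (measurable_id.prodMk measurable_const)).const_mul v
  · simp
  · intro g h _ _ hg hh
    simp only [RKHS.coe_add, Pi.add_apply]
    exact hg.add hh
  · intro c g _ hg
    simpa using hg.const_mul c

theorem stronglyMeasurable_kSec [TopologicalSpace.SeparableSpace H]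
    (hK : Measurable fun p : X × X => K H p.1 p.2) :
    StronglyMeasurable fun x => kSec H x := by
  borelize H
  have : SecondCountableTopology H := UniformSpace.secondCountable_of_separable H
  have hball : ∀ (f : H) (r : ℝ), MeasurableSet {x | kSec H x ∈ Metric.ball f r} := by
    intro f r
    have h : (fun x => dist (kSec H x) f) = fun x => √(K H x x - 2 * f x + ‖f‖ ^ 2) := by
      funext x
      rw [← norm_kSec_sq, ← inner_kSec, ← norm_sub_sq_real, Real.sqrt_sq (norm_nonneg _),
        dist_eq_norm]
    have hm : Measurable fun x => dist (kSec H x) f := by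
      rw [h]
      exact ((((hK.comp (measurable_id.prodMk measurable_id)).sub
        ((measurable_coe hK f).const_mul 2))).add_const _).sqrt
    exact measurableSet_lt hm measurable_const
  have hmeas : Measurable fun x => kSec H x := by
    refine measurable_of_isOpen fun s hs => ?_
    obtain ⟨c, hc, hcd⟩ := TopologicalSpace.exists_countable_dense H
    have hs' : s = ⋃ f ∈ c, ⋃ q : ℚ, ⋃ _ : Metric.ball f (q : ℝ) ⊆ s, Metric.ball f (q : ℝ) := by
      ext y
      simp only [Set.mem_iUnion, exists_prop]
      constructor
      · intro hy
        obtain ⟨ε, hε, hsub⟩ := Metric.isOpen_iff.1 hs y hy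
        obtain ⟨f, hfc, hf⟩ := hcd.exists_dist_lt y (half_pos hε)
        obtain ⟨q, hq1, hq2⟩ := exists_rat_btwn hf
        refine ⟨f, hfc, q, fun z hz => hsub ?_, hq1⟩
        have := dist_triangle z f y
        rw [Metric.mem_ball] at hz ⊢
        rw [dist_comm f y] at this
        linarith
      · rintro ⟨f, _, q, hsub, hy⟩
        exact hsub hy
    rw [hs']
    simp only [Set.preimage_iUnion]
    exact MeasurableSet.biUnion hc fun f _ => MeasurableSet.iUnion fun q =>
      MeasurableSet.iUnion fun _ => hball f q
  exact hmeas.stronglyMeasurable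

theorem integrable_kOp [TopologicalSpace.SeparableSpace H] (ν : Measure X)
    [IsFiniteMeasure ν] (hK : Measurable fun p : X × X => K H p.1 p.2)
    (κ : ℝ) (hκ : ∀ x : X, K H x x ≤ κ ^ 2) : Integrable (fun x => kOp H x) ν := by
  have hs : StronglyMeasurable fun x => kOp H x := by
    have hc : Continuous fun v : H => InnerProductSpace.rankOne ℝ v v :=
      (InnerProductSpace.rankOne ℝ (E := H) (F := H)).continuous.clm_apply continuous_id
    exact hc.comp_stronglyMeasurable (stronglyMeasurable_kSec hK)
  refine Integrable.of_bound hs.aestronglyMeasurable (κ ^ 2) (ae_of_all _ fun x => ?_)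
  rw [kOp, InnerProductSpace.norm_rankOne, ← sq, norm_kSec_sq]
  exact hκ x

/-- For a bounded measurable kernel, `covOp` is `f ↦ ∫ f(x) K(x, ·) dν(x)`. -/
theorem covOp_apply [TopologicalSpace.SeparableSpace H] (ν : Measure X)
    [IsFiniteMeasure ν] (hK : Measurable fun p : X × X => K H p.1 p.2)
    (κ : ℝ) (hκ : ∀ x : X, K H x x ≤ κ ^ 2) (f : H) :
    covOp H ν f = ∫ x, f x • kSec H x ∂ν := by
  rw [covOp, ContinuousLinearMap.integral_apply (integrable_kOp ν hK κ hκ)]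
  simp only [kOp_apply]

end Kernel

end EffDim

end

/-! Put `φ x = κ⁻¹ K(x,·)`, so `‖φ‖ ≤ 1`; the two scaled operators are `T = E[φ ⊗ φ]` and its
empirical version `S`. Write `R = (T + lam)⁻¹` and `G = (S + lam)⁻¹ S`. Then `T R - G = (T - S) R -
G (T - S) R` (`resolventMul_sub_resolventMul`). The trace of the first term is the deviation of an
empirical mean of `⟪φ, R φ⟫`. The second is at most `‖G‖ ‖(T - S) R‖` in Hilbert-Schmidt norm, and
`G² ≤ G` gives `‖G‖² ≤ tr G`, the empirical dimension.

Both deviations concern random vectors of norm at most `1/lam` and second moment at most `N/lam`,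
because `lam R² ≤ R` and `E⟪φ, R φ⟫ = N`. Bernstein's inequality in Hilbert space
(`bernstein_norm_mean`), applied to each, gives `|N - N_x| ≤ δ (√N + δ) (1 + √N_x)` outside an event
of probability `η`. The claims follow from this by algebra (`sqrt_max_comparison`). -/

namespace EffDim

/-! ### Inequalities for the hyperbolic cosine -/

/-- `u ↦ cosh √u` is convex on `[0, ∞)`. -/
theorem cosh_sqrt_convex_combination {a b r s x : ℝ} (ha : 0 ≤ a) (hb : 0 ≤ b) (hab : a + b = 1)
    (hx : x ^ 2 = a * r ^ 2 + b * s ^ 2) :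
    Real.cosh x ≤ a * Real.cosh r + b * Real.cosh s := by
  -- The power series of `cosh` has nonnegative coefficients and terms `(x²)^k`, each convex in
  -- `x²`.
  refine hasSum_le (fun k => ?_) (Real.hasSum_cosh x)
    (((Real.hasSum_cosh r).mul_left a).add ((Real.hasSum_cosh s).mul_left b))
  have h := (convexOn_pow (𝕜 := ℝ) k).2 (x := r ^ 2) (y := s ^ 2)
    (Set.mem_Ici.2 (sq_nonneg r)) (Set.mem_Ici.2 (sq_nonneg s)) ha hb hab
  simp only [smul_eq_mul] at h
  rw [pow_mul, pow_mul, pow_mul, hx, mul_div_assoc', mul_div_assoc', ← add_div]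
  gcongr

/-- The collinear cases of `cosh_norm_add_le`. Both follow from the addition formulas, `ρ ≤ sinh ρ`,
`sinh r ≤ cosh r` and `exp ρ ≤ 1 + ρ + ρ²`. -/
theorem cosh_add_le {r ρ : ℝ} (hr : 0 ≤ r) (hρ : 0 ≤ ρ) (hρ1 : ρ ≤ 1) :
    Real.cosh (r + ρ) ≤ Real.cosh r * (1 + ρ ^ 2) + ρ * Real.sinh r ∧
      Real.cosh (r - ρ) ≤ Real.cosh r * (1 + ρ ^ 2) - ρ * Real.sinh r := by
  have he : Real.exp ρ - 1 - ρ ≤ ρ ^ 2 :=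
    (le_abs_self _).trans (Real.abs_exp_sub_one_sub_id_le (by rwa [abs_of_nonneg hρ]))
  have h1 : Real.cosh ρ + Real.sinh ρ = Real.exp ρ := Real.cosh_add_sinh ρ
  have h2 : 0 ≤ Real.sinh r := Real.sinh_nonneg_iff.2 hr
  have h3 : Real.sinh r ≤ Real.cosh r := (Real.sinh_lt_cosh r).le
  have h4 : ρ ≤ Real.sinh ρ := Real.self_le_sinh_iff.2 hρ
  have h5 : 1 ≤ Real.cosh ρ := Real.one_le_cosh ρ
  rw [Real.cosh_add, Real.cosh_sub]
  constructor
  · nlinarith [mul_le_mul_of_nonneg_left h3 (sub_nonneg.2 h4),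
      mul_le_mul_of_nonneg_left he (h2.trans h3)]
  · nlinarith [mul_nonneg h2 (sub_nonneg.2 h4), mul_nonneg (h2.trans h3) (sub_nonneg.2 h4),
      mul_le_mul_of_nonneg_left he (h2.trans h3)]

/-! ### Bernstein's inequality in a Hilbert space -/

section Bernstein

variable {V : Type*} [NormedAddCommGroup V] [InnerProductSpace ℝ V]

/-- Second-order expansion of `cosh ‖·‖` with a bound on the remainder. -/
theorem cosh_norm_add_le (x y : V) (hy : ‖y‖ ≤ 1) :
    Real.cosh ‖y + x‖ ≤
      Real.cosh ‖x‖ * (1 + ‖y‖ ^ 2) + Real.sinh ‖x‖ / ‖x‖ * ⟪x, y⟫_ℝ := by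
  rcases eq_or_ne y 0 with rfl | hy0
  · simp
  rcases eq_or_ne x 0 with rfl | hx0
  · simpa using (cosh_add_le le_rfl (norm_nonneg y) hy).1
  have hr : 0 < ‖x‖ := norm_pos_iff.2 hx0
  have hρ : 0 < ‖y‖ := norm_pos_iff.2 hy0
  set r := ‖x‖
  set ρ := ‖y‖
  set p := ⟪x, y⟫_ℝ with hp
  have hpa : |p| ≤ r * ρ := abs_real_inner_le_norm x y
  obtain ⟨hp1, hp2⟩ := abs_le.1 hpa
  obtain ⟨h1, h2⟩ := cosh_add_le hr.le hρ.le hy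
  have hrρ : 0 < r * ρ := mul_pos hr hρ
  -- `‖y + x‖²` is the convex combination of `(r + ρ)²` and `(r - ρ)²` with these weights, so
  -- convexity reduces to collinear vectors.
  have ha : 0 ≤ (r * ρ + p) / (2 * (r * ρ)) := div_nonneg (by linarith) (by linarith)
  have hb : 0 ≤ (r * ρ - p) / (2 * (r * ρ)) := div_nonneg (by linarith) (by linarith)
  have hc := cosh_sqrt_convex_combination (r := r + ρ) (s := r - ρ) (x := ‖y + x‖) ha hb
    (by field_simp; ring) (by
      rw [add_comm y x, norm_add_sq_real]
      change r ^ 2 + 2 * p + ρ ^ 2 = _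
      field_simp
      ring)
  refine hc.trans ((add_le_add (mul_le_mul_of_nonneg_left h1 ha)
    (mul_le_mul_of_nonneg_left h2 hb)).trans (le_of_eq ?_))
  field_simp
  ring

variable {X : Type*}

theorem stronglyMeasurable_sum_eval {V : Type*} [NormedAddCommGroup V] [MeasurableSpace X] {f : X → V} (hf : StronglyMeasurable f) (n : ℕ) :
    StronglyMeasurable fun y : Fin n → X => ∑ j, f (y j) := by
  have := Finset.stronglyMeasurable_sum (M := V) Finset.univ
    (f := fun (j : Fin n) (y : Fin n → X) => f (y j))
    fun j _ => hf.comp_measurable (measurable_pi_apply j)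
  simpa [Finset.sum_fn] using this

theorem norm_sum_eval_le {V : Type*} [NormedAddCommGroup V] {f : X → V} {M : ℝ} (hM : ∀ x, ‖f x‖ ≤ M) {n : ℕ} (y : Fin n → X) :
    ‖∑ j, f (y j)‖ ≤ n * M := by
  refine (norm_sum_le_of_le Finset.univ fun j _ => hM (y j)).trans ?_
  simp

theorem integrable_cosh_norm {V Y : Type*} [NormedAddCommGroup V] [MeasurableSpace Y]
    (μ : Measure Y) [IsFiniteMeasure μ] {g : Y → V} (hg : StronglyMeasurable g) {C : ℝ} (hC : ∀ y, ‖g y‖ ≤ C) :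
    Integrable (fun y => Real.cosh ‖g y‖) μ := by
  refine Integrable.of_bound (Real.continuous_cosh.comp_stronglyMeasurable
    hg.norm).aestronglyMeasurable (Real.cosh C) (ae_of_all _ fun y => ?_)
  rw [Real.norm_eq_abs, abs_of_pos (Real.cosh_pos _), Real.cosh_le_cosh,
    abs_of_nonneg (norm_nonneg _)]
  exact (hC y).trans (le_abs_self C)

variable [CompleteSpace V] [MeasurableSpace X]

/-- Exponential moment bound for a sum of independent centered vectors of norm at most `1`. -/
theorem integral_cosh_norm_sum_le (ν : Measure X) [IsProbabilityMeasure ν] {f : X → V}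
    (hf : StronglyMeasurable f) (hf1 : ∀ x, ‖f x‖ ≤ 1) (h0 : ∫ x, f x ∂ν = 0) {v : ℝ}
    (hv : ∫ x, ‖f x‖ ^ 2 ∂ν ≤ v) (n : ℕ) :
    ∫ y, Real.cosh ‖∑ j, f (y j)‖ ∂(Measure.pi fun _ : Fin n => ν) ≤ (1 + v) ^ n := by
  have hfi : Integrable f ν := Integrable.of_bound hf.aestronglyMeasurable 1 (ae_of_all _ hf1)
  have hf2 : Integrable (fun x => ‖f x‖ ^ 2) ν :=
    Integrable.of_bound (hf.norm.pow 2).aestronglyMeasurable 1 (ae_of_all _ fun x => by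
      rw [Real.norm_of_nonneg (by positivity)]
      exact pow_le_one₀ (norm_nonneg _) (hf1 x))
  have hv0 : 0 ≤ v := (integral_nonneg fun x => by positivity).trans hv
  induction n with
  | zero => simp
  | succ n ih =>
    have hS := stronglyMeasurable_sum_eval hf n
    -- The term linear in `f a` integrates to zero, so each new summand costs a factor `1 + v`.
    have hstep : ∀ s : V, ∫ a, Real.cosh ‖f a + s‖ ∂ν ≤ Real.cosh ‖s‖ * (1 + v) := by
      intro s
      have hi1 : Integrable (fun a => Real.cosh ‖s‖ * (1 + ‖f a‖ ^ 2)) ν :=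
        ((integrable_const 1).add hf2).const_mul _
      have hi2 : Integrable (fun a => Real.sinh ‖s‖ / ‖s‖ * ⟪s, f a⟫_ℝ) ν :=
        (hfi.const_inner s).const_mul _
      calc ∫ a, Real.cosh ‖f a + s‖ ∂ν
          ≤ ∫ a, (Real.cosh ‖s‖ * (1 + ‖f a‖ ^ 2)
              + Real.sinh ‖s‖ / ‖s‖ * ⟪s, f a⟫_ℝ) ∂ν :=
            integral_mono (integrable_cosh_norm ν (hf.add stronglyMeasurable_const)
              (C := 1 + ‖s‖) fun a => (norm_add_le _ _).trans (by gcongr; exact hf1 a))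
              (hi1.add hi2) fun a => cosh_norm_add_le s (f a) (hf1 a)
        _ = Real.cosh ‖s‖ * (1 + ∫ a, ‖f a‖ ^ 2 ∂ν) := by
            rw [integral_add hi1 hi2, integral_const_mul, integral_const_mul,
              integral_add (integrable_const 1) hf2, integral_inner hfi, h0]
            simp
        _ ≤ Real.cosh ‖s‖ * (1 + v) := by
            gcongr
    have hmp := (measurePreserving_piFinSuccAbove (fun _ : Fin (n + 1) => ν) 0).symm
    have hint : Integrable (fun p : X × (Fin n → X) => Real.cosh ‖f p.1 + ∑ j, f (p.2 j)‖)
        (ν.prod (Measure.pi fun _ : Fin n => ν)) :=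
      integrable_cosh_norm _ ((hf.comp_measurable measurable_fst).add
        (hS.comp_measurable measurable_snd)) (C := 1 + n * 1)
        fun p => (norm_add_le _ _).trans (add_le_add (hf1 _) (norm_sum_eval_le hf1 p.2))
    calc ∫ y, Real.cosh ‖∑ j, f (y j)‖ ∂(Measure.pi fun _ : Fin (n + 1) => ν)
        = ∫ p : X × (Fin n → X), Real.cosh ‖f p.1 + ∑ j, f (p.2 j)‖
            ∂(ν.prod (Measure.pi fun _ : Fin n => ν)) := by
          rw [← hmp.integral_comp']
          simp [MeasurableEquiv.piFinSuccAbove, Fin.sum_univ_succ, Fin.insertNthEquiv]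
      _ = ∫ y, ∫ a, Real.cosh ‖f a + ∑ j, f (y j)‖ ∂ν ∂(Measure.pi fun _ : Fin n => ν) :=
          integral_prod_symm _ hint
      _ ≤ ∫ y, Real.cosh ‖∑ j, f (y j)‖ * (1 + v) ∂(Measure.pi fun _ : Fin n => ν) :=
          integral_mono hint.integral_prod_right
            ((integrable_cosh_norm _ hS (norm_sum_eval_le hf1)).mul_const _) fun y => hstep _
      _ ≤ (1 + v) ^ (n + 1) := by
          rw [integral_mul_const, pow_succ]
          gcongr

/-- Bernstein's inequality for the mean of independent bounded vectors in a Hilbert space. -/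
theorem bernstein_norm_mean (ν : Measure X) [IsProbabilityMeasure ν] {f : X → V}
    (hf : StronglyMeasurable f) {M σ L : ℝ} (hM : 0 < M) (hσ : 0 ≤ σ) (hL : 1 ≤ L)
    (hfM : ∀ x, ‖f x‖ ≤ M) (h0 : ∫ x, f x ∂ν = 0) (hv : ∫ x, ‖f x‖ ^ 2 ∂ν ≤ σ ^ 2)
    {n : ℕ} (hn : 1 ≤ n) :
    (Measure.pi fun _ : Fin n => ν).real
      {y | 2 * L * (M / n + σ / √n) ≤ ‖(n : ℝ)⁻¹ • ∑ j, f (y j)‖} ≤ 2 * Real.exp (-L) := by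
  have hn0 : (0 : ℝ) < n := by exact_mod_cast hn
  have hsn : 0 < √(n : ℝ) := Real.sqrt_pos.2 hn0
  have hsq : √(n : ℝ) ^ 2 = n := Real.sq_sqrt hn0.le
  -- Dividing by `Q` makes the vectors bounded by `1` with second moment at most `1/n`, so the
  -- moment bound is `(1 + 1/n)^n ≤ e`.
  set Q := M + σ * √n with hQ
  have hQ0 : 0 < Q := by positivity
  have hMQ : M ≤ Q := by simp only [hQ]; nlinarith [mul_nonneg hσ hsn.le]
  set g : X → V := fun x => Q⁻¹ • f x with hg
  have hgm : StronglyMeasurable g := hf.const_smul _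
  have hgn : ∀ x, ‖g x‖ = Q⁻¹ * ‖f x‖ := fun x => by
    rw [hg, norm_smul, Real.norm_of_nonneg (by positivity)]
  have hg1 : ∀ x, ‖g x‖ ≤ 1 := fun x => by
    rw [hgn, inv_mul_le_iff₀ hQ0, mul_one]
    exact (hfM x).trans hMQ
  have hg0 : ∫ x, g x ∂ν = 0 := by simp only [hg, integral_smul, h0, smul_zero]
  have hgv : ∫ x, ‖g x‖ ^ 2 ∂ν ≤ (n : ℝ)⁻¹ := by
    simp only [hgn, mul_pow, integral_const_mul]
    calc Q⁻¹ ^ 2 * ∫ x, ‖f x‖ ^ 2 ∂ν ≤ Q⁻¹ ^ 2 * σ ^ 2 := by gcongr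
      _ ≤ (n : ℝ)⁻¹ := by
        rw [inv_pow, inv_mul_le_iff₀ (by positivity), ← div_eq_mul_inv, le_div_iff₀ hn0]
        nlinarith [mul_nonneg hσ hsn.le, mul_nonneg hM.le (mul_nonneg hσ hsn.le), sq_nonneg M]
  have hcosh : ∫ y, Real.cosh ‖∑ j, g (y j)‖ ∂(Measure.pi fun _ : Fin n => ν) ≤ Real.exp 1 := by
    refine (integral_cosh_norm_sum_le ν hgm hg1 hg0 hgv n).trans ?_
    calc (1 + (n : ℝ)⁻¹) ^ n ≤ Real.exp (n : ℝ)⁻¹ ^ n := by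
          gcongr
          linarith [Real.add_one_le_exp (n : ℝ)⁻¹]
      _ = Real.exp 1 := by rw [← Real.exp_nat_mul, mul_inv_cancel₀ hn0.ne']
  have hsub : {y : Fin n → X | 2 * L * (M / n + σ / √n) ≤ ‖(n : ℝ)⁻¹ • ∑ j, f (y j)‖} ⊆
      {y | Real.exp (2 * L) / 2 ≤ Real.cosh ‖∑ j, g (y j)‖} := by
    intro y hy
    simp only [Set.mem_ofPred_eq] at hy ⊢
    have h1 : ‖∑ j, g (y j)‖ = Q⁻¹ * ‖∑ j, f (y j)‖ := by
      rw [hg, ← Finset.smul_sum, norm_smul, Real.norm_of_nonneg (by positivity)]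
    have h2 : 2 * L ≤ ‖∑ j, g (y j)‖ := by
      rw [norm_smul, Real.norm_of_nonneg (by positivity), ← div_eq_inv_mul, le_div_iff₀ hn0] at hy
      rw [h1, ← div_eq_inv_mul, le_div_iff₀ hQ0]
      refine le_trans (le_of_eq ?_) hy
      have h3 : σ / √n * n = σ * √n := by
        nth_rewrite 2 [← hsq]
        field_simp
      rw [mul_assoc (2 * L), add_mul, div_mul_cancel₀ M hn0.ne', h3]
    rw [Real.cosh_eq]
    have h3 := Real.exp_le_exp.2 h2
    have h4 := Real.exp_pos (-‖∑ j, g (y j)‖)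
    linarith
  have hmarkov := mul_meas_ge_le_integral_of_nonneg
    (μ := Measure.pi fun _ : Fin n => ν) (f := fun y => Real.cosh ‖∑ j, g (y j)‖)
    (ae_of_all _ fun y => (Real.cosh_pos _).le)
    (integrable_cosh_norm _ (stronglyMeasurable_sum_eval hgm n) (norm_sum_eval_le hg1))
    (Real.exp (2 * L) / 2)
  refine (measureReal_mono hsub).trans ?_
  -- Markov's inequality leaves `2 exp (1 - 2L)`; `1 ≤ L` turns it into `2 exp (-L)`.
  have h5 : Real.exp (2 * L) / 2 * (Measure.pi fun _ : Fin n => ν).real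
      {y | Real.exp (2 * L) / 2 ≤ Real.cosh ‖∑ j, g (y j)‖} ≤ Real.exp L :=
    (hmarkov.trans hcosh).trans (Real.exp_le_exp.2 hL)
  rw [two_mul, Real.exp_add] at h5
  rw [Real.exp_neg, ← div_eq_mul_inv, le_div_iff₀ (Real.exp_pos L)]
  have h6 := Real.exp_pos L
  rw [two_mul L, Real.exp_add]
  nlinarith

end Bernstein

/-! ### Operator inequalities for the resolvent -/

section Resolvent

variable {H : Type*} [NormedAddCommGroup H] [InnerProductSpace ℝ H] [CompleteSpace H]

/-- The inverse of `T + lam` in the algebra of bounded operators. -/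
noncomputable def res (T : H →L[ℝ] H) (lam : ℝ) : H →L[ℝ] H :=
  Ring.inverse (T + lam • (1 : H →L[ℝ] H))

variable {T : H →L[ℝ] H} {lam : ℝ}

/-- Coercivity: `⟪(T + lam) x, x⟫ ≥ lam ‖x‖²`. -/
theorem isUnit_add_smul_one (hT : T.IsPositive) (hlam : 0 < lam) :
    IsUnit (T + lam • (1 : H →L[ℝ] H)) := by
  refine ContinuousLinearMap.isUnit_of_forall_le_norm_inner_map _ (c := ⟨lam, hlam.le⟩) hlam
    fun x => ?_
  have h : 0 ≤ ⟪T x, x⟫_ℝ := hT.inner_nonneg_left x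
  refine le_trans ?_ (Real.le_norm_self _)
  have h2 : ⟪(T + lam • (1 : H →L[ℝ] H)) x, x⟫_ℝ = ⟪T x, x⟫_ℝ + lam * ‖x‖ ^ 2 := by
    rw [← real_inner_self_eq_norm_sq x, ← real_inner_smul_left, ← inner_add_left]
    rfl
  rw [h2]
  change ‖x‖ ^ 2 * lam ≤ _
  linarith

theorem apply_res_add (hT : T.IsPositive) (hlam : 0 < lam) (x : H) :
    T (res T lam x) + lam • res T lam x = x := by
  have h := Ring.mul_inverse_cancel _ (isUnit_add_smul_one hT hlam)
  exact congrArg (fun A : H →L[ℝ] H => A x) h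

theorem res_apply_add (hT : T.IsPositive) (hlam : 0 < lam) (x : H) :
    res T lam (T x) + lam • res T lam x = x := by
  have h := Ring.inverse_mul_cancel _ (isUnit_add_smul_one hT hlam)
  rw [← map_smul, ← map_add]
  exact congrArg (fun A : H →L[ℝ] H => A x) h

theorem resolventMul_apply {H : Type*} [NormedAddCommGroup H] [InnerProductSpace ℝ H]
    (T : H →L[ℝ] H) (lam : ℝ) (x : H) :
    resolventMul T lam x = res T lam (T x) := rfl

theorem resolventMul_apply_comm (hT : T.IsPositive) (hlam : 0 < lam) (x : H) :
    resolventMul T lam x = T (res T lam x) :=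
  add_right_cancel ((res_apply_add hT hlam x).trans (apply_res_add hT hlam x).symm)

theorem inner_res_comm (hT : T.IsPositive) (hlam : 0 < lam) (x y : H) :
    ⟪res T lam x, y⟫_ℝ = ⟪x, res T lam y⟫_ℝ := by
  have hs := hT.inner_left_eq_inner_right (res T lam x) (res T lam y)
  nth_rewrite 1 [← apply_res_add hT hlam y]
  nth_rewrite 2 [← apply_res_add hT hlam x]
  rw [inner_add_left, inner_add_right, hs, real_inner_smul_left, real_inner_smul_right]

/-- This is `lam R² ≤ R`, the source of both the bound `1/lam` and the variance bound `N/lam`. Pair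
`x = T u + lam u` with `u = R x` and drop `⟪T u, u⟫`. -/
theorem mul_norm_res_sq_le (hT : T.IsPositive) (hlam : 0 < lam) (x : H) :
    lam * ‖res T lam x‖ ^ 2 ≤ ⟪x, res T lam x⟫_ℝ := by
  have h : 0 ≤ ⟪T (res T lam x), res T lam x⟫_ℝ := hT.inner_nonneg_left _
  nth_rewrite 2 [← apply_res_add hT hlam x]
  rw [inner_add_left, real_inner_smul_left, real_inner_self_eq_norm_sq]
  linarith

theorem norm_res_le (hT : T.IsPositive) (hlam : 0 < lam) (x : H) :
    ‖res T lam x‖ ≤ ‖x‖ / lam := by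
  rw [le_div_iff₀ hlam]
  have h1 := (mul_norm_res_sq_le hT hlam x).trans (real_inner_le_norm _ _)
  rcases (norm_nonneg (res T lam x)).eq_or_lt' with h | h
  · simp [h]
  · nlinarith

theorem inner_res_nonneg (hT : T.IsPositive) (hlam : 0 < lam) (x : H) :
    0 ≤ ⟪x, res T lam x⟫_ℝ :=
  (by positivity : 0 ≤ lam * ‖res T lam x‖ ^ 2).trans (mul_norm_res_sq_le hT hlam x)

theorem inner_resolventMul_comm (hT : T.IsPositive) (hlam : 0 < lam) (x y : H) :
    ⟪resolventMul T lam x, y⟫_ℝ = ⟪x, resolventMul T lam y⟫_ℝ := by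
  rw [resolventMul_apply, inner_res_comm hT hlam, hT.inner_left_eq_inner_right,
    resolventMul_apply_comm hT hlam]

/-- This is `G² ≤ G`: with `u = R x`, the right side is `‖T u‖² + lam ⟪u, T u⟫`. It bounds the
squared Hilbert-Schmidt norm by the trace. -/
theorem norm_resolventMul_sq_le (hT : T.IsPositive) (hlam : 0 < lam) (x : H) :
    ‖resolventMul T lam x‖ ^ 2 ≤ ⟪x, resolventMul T lam x⟫_ℝ := by
  have h : 0 ≤ ⟪res T lam x, T (res T lam x)⟫_ℝ := hT.inner_nonneg_right _
  rw [resolventMul_apply_comm hT hlam]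
  nth_rewrite 2 [← apply_res_add hT hlam x]
  rw [inner_add_left, real_inner_smul_left, real_inner_self_eq_norm_sq]
  nlinarith

theorem isPositive_resolventMul (hT : T.IsPositive) (hlam : 0 < lam) :
    (resolventMul T lam).IsPositive := by
  rw [ContinuousLinearMap.isPositive_def]
  refine ⟨fun x y => inner_resolventMul_comm hT hlam x y, fun x => ?_⟩
  simp only [ContinuousLinearMap.reApplyInnerSelf_apply, RCLike.re_to_real]
  rw [real_inner_comm]
  exact (sq_nonneg _).trans (norm_resolventMul_sq_le hT hlam x)

theorem mul_inner_resolventMul_le (hT : T.IsPositive) (hlam : 0 < lam) (x : H) :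
    lam * ⟪x, resolventMul T lam x⟫_ℝ ≤ ⟪x, T x⟫_ℝ := by
  set u := res T lam x with hu
  have hx : x = T u + lam • u := (apply_res_add hT hlam x).symm
  have h : 0 ≤ ⟪T u, T (T u)⟫_ℝ := hT.inner_nonneg_right _
  have h2 : 0 ≤ ⟪T u, T u⟫_ℝ := real_inner_self_nonneg
  have h3 : ⟪u, T (T u)⟫_ℝ = ⟪T u, T u⟫_ℝ := (hT.inner_left_eq_inner_right _ _).symm
  rw [resolventMul_apply_comm hT hlam, ← hu, hx]
  simp only [map_add, map_smul, inner_add_left, inner_add_right, real_inner_smul_left,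
    real_inner_smul_right, h3]
  nlinarith

theorem summable_inner_resolventMul {ι : Type*} (b : HilbertBasis ι ℝ H) {T : H →L[ℝ] H}
    (hT : T.IsPositive) (hlam : 0 < lam) (hsum : Summable fun i => ⟪b i, T (b i)⟫_ℝ) :
    Summable fun i => ⟪b i, resolventMul T lam (b i)⟫_ℝ := by
  refine Summable.of_nonneg_of_le
    (fun i => (isPositive_resolventMul hT hlam).inner_nonneg_right (b i)) (fun i => ?_)
    (hsum.mul_left lam⁻¹)
  rw [← div_eq_inv_mul, le_div_iff₀' hlam]
  exact mul_inner_resolventMul_le hT hlam _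

theorem isTraceClass_resolventMul (hT : T.IsPositive) (hlam : 0 < lam)
    (hsum : ∀ (w : Set H) (b : HilbertBasis w ℝ H), Summable fun i => ⟪b i, T (b i)⟫_ℝ) :
    IsTraceClass (resolventMul T lam) := by
  have hG := isPositive_resolventMul hT hlam
  -- A positive operator is its own modulus.
  refine ⟨resolventMul T lam, hG, ?_, fun w b => ?_⟩
  · rw [hG.isSelfAdjoint.adjoint_eq]
  · exact summable_inner_resolventMul b hT hlam (hsum w b)

/-- Decomposition of the difference of the operators defining two effective dimensions. -/
theorem resolventMul_sub_resolventMul {S : H →L[ℝ] H} (hT : T.IsPositive) (hS : S.IsPositive)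
    (hlam : 0 < lam) (u : H) :
    resolventMul T lam u - resolventMul S lam u =
      (T (res T lam u) - S (res T lam u)) -
        resolventMul S lam (T (res T lam u) - S (res T lam u)) := by
  set r := res T lam u with hr
  -- With `G` built from `S`, the right side is `(1 - G)(T - S) r`; substitute `T r = u - lam r` and
  -- `G S r = S r - lam G r`.
  have h1 : T r = u - lam • r := eq_sub_of_add_eq (apply_res_add hT hlam u)
  have h2 : resolventMul S lam (S r) + lam • resolventMul S lam r = S r := by
    rw [resolventMul_apply_comm hS hlam, resolventMul_apply_comm hS hlam, ← map_smul, ← map_add,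
      res_apply_add hS hlam]
  rw [resolventMul_apply_comm hT hlam, ← hr, map_sub, h1, map_sub, map_smul]
  rw [← sub_eq_zero]
  rw [← sub_eq_zero] at h2
  rw [← neg_eq_zero, ← h2]
  abel

end Resolvent

/-! ### Hilbert-Schmidt operators as square-summable families -/

section HilbertSchmidt

variable {ι H : Type*} [NormedAddCommGroup H] [InnerProductSpace ℝ H]

theorem hasSum_norm_sq_inner (b : HilbertBasis ι ℝ H) (u : H) :
    HasSum (fun i => ⟪b i, u⟫_ℝ ^ 2) (‖u‖ ^ 2) := by
  have h := b.hasSum_inner_mul_inner u u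
  rw [real_inner_self_eq_norm_sq] at h
  refine h.congr_fun fun i => ?_
  rw [real_inner_comm, sq]

theorem memℓp_two_of_summable_norm_sq {H : Type*} [NormedAddCommGroup H] {f : ι → H} (hf : Summable fun i => ‖f i‖ ^ 2) :
    Memℓp f 2 := memℓp_gen (by simpa using hf)

theorem norm_sq_eq_tsum (f : lp (fun _ : ι => H) 2) : ‖f‖ ^ 2 = ∑' i, ‖f i‖ ^ 2 := by
  have h := lp.inner_eq_tsum (𝕜 := ℝ) f f
  simpa only [real_inner_self_eq_norm_sq] using h

/-- The family `(⟪b i, u⟫ • v)_i`, i.e. the rank-one operator `w ↦ ⟪u, w⟫ • v` as an element of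
the Hilbert space of Hilbert-Schmidt operators, represented by the images of a basis. -/
noncomputable def hsRankOne (b : HilbertBasis ι ℝ H) : H →L[ℝ] H →L[ℝ] lp (fun _ : ι => H) 2 :=
  LinearMap.mkContinuous₂
    (LinearMap.mk₂ ℝ
      (fun u v => ⟨fun i => ⟪b i, u⟫_ℝ • v, memℓp_two_of_summable_norm_sq (by
        simpa only [norm_smul, mul_pow, Real.norm_eq_abs, sq_abs] using
          (hasSum_norm_sq_inner b u).summable.mul_right (‖v‖ ^ 2))⟩)
      (fun u u' v => by ext i; simp [inner_add_right, add_smul]; rfl)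
      (fun c u v => by ext i; simp [real_inner_smul_right, mul_smul])
      (fun u v v' => by ext i; simp; rfl)
      (fun c u v => by ext i; simp [smul_comm c]))
    1 (fun u v => by
      rw [one_mul]
      refine le_of_sq_le_sq ?_ (by positivity)
      rw [norm_sq_eq_tsum, mul_pow]
      refine le_of_eq (((hasSum_norm_sq_inner b u).mul_right (‖v‖ ^ 2)).congr_fun
        fun i => ?_).tsum_eq
      simp [norm_smul, mul_pow])

theorem hsRankOne_apply (b : HilbertBasis ι ℝ H) (u v : H) (i : ι) :
    hsRankOne b u v i = ⟪b i, u⟫_ℝ • v := rfl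

theorem norm_hsRankOne_le (b : HilbertBasis ι ℝ H) (u v : H) :
    ‖hsRankOne b u v‖ ≤ ‖u‖ * ‖v‖ := by
  refine le_of_sq_le_sq ?_ (by positivity)
  rw [norm_sq_eq_tsum, mul_pow]
  refine le_of_eq (((hasSum_norm_sq_inner b u).mul_right (‖v‖ ^ 2)).congr_fun
    fun i => ?_).tsum_eq
  simp [hsRankOne_apply, norm_smul, mul_pow]

/-- Basis vectors lie at distance `√2 > 1`. Countability later permits exchanging the trace sum with
an integral. -/
theorem countable_of_hilbertBasis [TopologicalSpace.SeparableSpace H] (b : HilbertBasis ι ℝ H) :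
    Countable ι := by
  refine Pairwise.countable_of_isOpen_disjoint (s := fun i => Metric.ball (b i) (1 / 2))
    (fun i j hij => Metric.ball_disjoint_ball ?_) (fun i => Metric.isOpen_ball)
    fun i => ⟨b i, Metric.mem_ball_self (by norm_num)⟩
  have h : ‖b i - b j‖ ^ 2 = 2 := by
    rw [norm_sub_sq_real, b.orthonormal.2 hij, b.orthonormal.1 i, b.orthonormal.1 j]
    norm_num
  rw [dist_eq_norm]
  nlinarith [norm_nonneg (b i - b j)]

end HilbertSchmidt

/-! ### Covariance operators and their traces -/

section SecondMoment

variable {ι X H : Type*} [NormedAddCommGroup H] [InnerProductSpace ℝ H]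

/-- The uncentered covariance operator `∫ φ(x) ⊗ φ(x) dν(x)`. -/
noncomputable def secondMoment [MeasurableSpace X] (ν : Measure X) (φ : X → H) : H →L[ℝ] H :=
  ∫ x, InnerProductSpace.rankOne ℝ (φ x) (φ x) ∂ν

/-- The empirical uncentered covariance operator. -/
noncomputable def empMoment (φ : X → H) {n : ℕ} (y : Fin n → X) : H →L[ℝ] H :=
  (n : ℝ)⁻¹ • ∑ j, InnerProductSpace.rankOne ℝ (φ (y j)) (φ (y j))

section Empirical

variable (φ : X → H) {n : ℕ} (y : Fin n → X)

theorem empMoment_apply (v : H) :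
    empMoment φ y v = (n : ℝ)⁻¹ • ∑ j, ⟪φ (y j), v⟫_ℝ • φ (y j) := by
  simp [empMoment, InnerProductSpace.rankOne_apply]

theorem isPositive_empMoment : (empMoment φ y).IsPositive := by
  refine ContinuousLinearMap.IsPositive.smul_of_nonneg ?_ (by positivity)
  exact ContinuousLinearMap.isPositive_sum _ fun j _ =>
    InnerProductSpace.isPositive_rankOne_self _

/-- Parseval: the trace of `(φ ⊗ φ) A` is `⟪φ, A φ⟫`. -/
theorem hasSum_inner_empMoment (b : HilbertBasis ι ℝ H) {A : H →L[ℝ] H}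
    (hA : ∀ u v, ⟪A u, v⟫_ℝ = ⟪u, A v⟫_ℝ) :
    HasSum (fun i => ⟪b i, empMoment φ y (A (b i))⟫_ℝ)
      ((n : ℝ)⁻¹ • ∑ j, ⟪φ (y j), A (φ (y j))⟫_ℝ) := by
  simp only [empMoment_apply, inner_smul_right_eq_smul, inner_sum]
  refine HasSum.const_smul _ (hasSum_sum fun j _ => ?_)
  refine (b.hasSum_inner_mul_inner (φ (y j)) (A (φ (y j)))).congr_fun fun i => ?_
  rw [← hA, real_inner_comm (b i) (φ (y j)), real_inner_comm (b i) (A (φ (y j))), smul_eq_mul,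
    mul_comm]

end Empirical

variable [MeasurableSpace X] (ν : Measure X) [IsProbabilityMeasure ν] {φ : X → H}

theorem integrable_rankOne (hφ : StronglyMeasurable φ) (hφ1 : ∀ x, ‖φ x‖ ≤ 1) :
    Integrable (fun x => InnerProductSpace.rankOne ℝ (φ x) (φ x)) ν := by
  have hc : Continuous fun v : H => InnerProductSpace.rankOne ℝ v v :=
    (InnerProductSpace.rankOne ℝ (E := H) (F := H)).continuous.clm_apply continuous_id
  refine Integrable.of_bound (hc.comp_stronglyMeasurable hφ).aestronglyMeasurable 1
    (ae_of_all _ fun x => ?_)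
  rw [InnerProductSpace.norm_rankOne]
  exact mul_le_one₀ (hφ1 x) (norm_nonneg _) (hφ1 x)

theorem secondMoment_apply (hφ : StronglyMeasurable φ) (hφ1 : ∀ x, ‖φ x‖ ≤ 1) (v : H) :
    secondMoment ν φ v = ∫ x, ⟪φ x, v⟫_ℝ • φ x ∂ν := by
  rw [secondMoment, ContinuousLinearMap.integral_apply (integrable_rankOne ν hφ hφ1)]
  simp only [InnerProductSpace.rankOne_apply]

theorem integrable_inner_smul (hφ : StronglyMeasurable φ) (hφ1 : ∀ x, ‖φ x‖ ≤ 1) (v : H) :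
    Integrable (fun x => ⟪φ x, v⟫_ℝ • φ x) ν := by
  simpa only [InnerProductSpace.rankOne_apply] using
    (integrable_rankOne ν hφ hφ1).apply_continuousLinearMap v

variable [CompleteSpace H]

theorem inner_secondMoment (hφ : StronglyMeasurable φ) (hφ1 : ∀ x, ‖φ x‖ ≤ 1) (u v : H) :
    ⟪u, secondMoment ν φ v⟫_ℝ = ∫ x, ⟪φ x, v⟫_ℝ * ⟪u, φ x⟫_ℝ ∂ν := by
  rw [secondMoment_apply ν hφ hφ1, ← integral_inner (integrable_inner_smul ν hφ hφ1 v)]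
  simp only [real_inner_smul_right]

theorem isPositive_secondMoment (hφ : StronglyMeasurable φ) (hφ1 : ∀ x, ‖φ x‖ ≤ 1) :
    (secondMoment ν φ).IsPositive := by
  rw [ContinuousLinearMap.isPositive_def]
  refine ⟨fun u v => ?_, fun u => ?_⟩
  · change ⟪secondMoment ν φ u, v⟫_ℝ = ⟪u, secondMoment ν φ v⟫_ℝ
    rw [real_inner_comm, inner_secondMoment ν hφ hφ1, inner_secondMoment ν hφ hφ1]
    refine integral_congr_ae (ae_of_all _ fun x => ?_)
    simp only [real_inner_comm (φ x)]
    ring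
  · simp only [ContinuousLinearMap.reApplyInnerSelf_apply, RCLike.re_to_real]
    rw [real_inner_comm, inner_secondMoment ν hφ hφ1]
    refine integral_nonneg fun x => ?_
    simp only [real_inner_comm (φ x)]
    exact mul_self_nonneg _

/-- Parseval under the integral sign. The exchange is justified by `|st| ≤ s² + t²` and Bessel's
inequality, which bounds the summed integrals of squared coordinates. -/
theorem hasSum_inner_secondMoment [Countable ι] (hφ : StronglyMeasurable φ)
    (hφ1 : ∀ x, ‖φ x‖ ≤ 1) (b : HilbertBasis ι ℝ H) {A : H →L[ℝ] H}
    (hA : ∀ u v, ⟪A u, v⟫_ℝ = ⟪u, A v⟫_ℝ) :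
    HasSum (fun i => ⟪b i, secondMoment ν φ (A (b i))⟫_ℝ) (∫ x, ⟪φ x, A (φ x)⟫_ℝ ∂ν) := by
  have hAφ : StronglyMeasurable fun x => A (φ x) := A.continuous.comp_stronglyMeasurable hφ
  have hAn : ∀ x, ‖A (φ x)‖ ≤ ‖A‖ := fun x => A.unit_le_opNorm _ (hφ1 x)
  have hsq : ∀ {ψ : X → H} {C : ℝ}, StronglyMeasurable ψ → (∀ x, ‖ψ x‖ ≤ C) → ∀ u : H,
      Integrable (fun x => ⟪u, ψ x⟫_ℝ ^ 2) ν := by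
    intro ψ C hψ hC u
    refine Integrable.of_bound
      ((stronglyMeasurable_const.inner hψ).pow 2).aestronglyMeasurable ((‖u‖ * C) ^ 2)
      (ae_of_all _ fun x => ?_)
    rw [norm_pow]
    gcongr
    exact (norm_inner_le_norm _ _).trans (by gcongr; exact hC x)
  have hsum : ∀ {ψ : X → H} {C : ℝ}, StronglyMeasurable ψ → (∀ x, ‖ψ x‖ ≤ C) →
      Summable fun i => ∫ x, ⟪b i, ψ x⟫_ℝ ^ 2 ∂ν := by
    intro ψ C hψ hC
    refine summable_of_sum_le (c := C ^ 2) (fun i => integral_nonneg fun x => sq_nonneg _)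
      fun s => ?_
    rw [← integral_finsetSum _ fun i _ => hsq hψ hC (b i)]
    have : ∫ _x, C ^ 2 ∂ν = C ^ 2 := by simp
    rw [← this]
    refine integral_mono (integrable_finsetSum _ fun i _ => hsq hψ hC (b i))
      (integrable_const _) fun x => ?_
    refine (sum_le_hasSum s (fun i _ => sq_nonneg _) (hasSum_norm_sq_inner b (ψ x))).trans ?_
    gcongr
    exact hC x
  have hbound : ∀ i x, ‖⟪b i, φ x⟫_ℝ * ⟪b i, A (φ x)⟫_ℝ‖ ≤
      ⟪b i, φ x⟫_ℝ ^ 2 + ⟪b i, A (φ x)⟫_ℝ ^ 2 := by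
    intro i x
    rw [Real.norm_eq_abs, abs_le]
    constructor <;> nlinarith [sq_nonneg (⟪b i, φ x⟫_ℝ + ⟪b i, A (φ x)⟫_ℝ),
      sq_nonneg (⟪b i, φ x⟫_ℝ - ⟪b i, A (φ x)⟫_ℝ), sq_nonneg ⟪b i, φ x⟫_ℝ,
      sq_nonneg ⟪b i, A (φ x)⟫_ℝ]
  have hint : ∀ i, Integrable (fun x => ⟪b i, φ x⟫_ℝ * ⟪b i, A (φ x)⟫_ℝ) ν := fun i =>
    ((hsq hφ hφ1 (b i)).add (hsq hAφ hAn (b i))).mono'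
      ((stronglyMeasurable_const.inner hφ).mul
        (stronglyMeasurable_const.inner hAφ)).aestronglyMeasurable (ae_of_all _ (hbound i))
  have h := hasSum_integral_of_summable_integral_norm hint
    (Summable.of_nonneg_of_le (fun i => integral_nonneg fun x => norm_nonneg _)
      (fun i => (integral_mono (hint i).norm
        ((hsq hφ hφ1 (b i)).add (hsq hAφ hAn (b i))) (hbound i)).trans_eq
          (integral_add (hsq hφ hφ1 (b i)) (hsq hAφ hAn (b i))))
      ((hsum hφ hφ1).add (hsum hAφ hAn)))
  have h2 : ∀ x, ∑' i, ⟪b i, φ x⟫_ℝ * ⟪b i, A (φ x)⟫_ℝ = ⟪φ x, A (φ x)⟫_ℝ := fun x => by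
    rw [← b.tsum_inner_mul_inner]
    exact tsum_congr fun i => by rw [real_inner_comm]
  simp only [h2] at h
  refine h.congr_fun fun i => ?_
  rw [inner_secondMoment ν hφ hφ1]
  refine integral_congr_ae (ae_of_all _ fun x => ?_)
  simp only
  rw [← hA, real_inner_comm (b i) (A (φ x)), mul_comm]

end SecondMoment

/-- Bernstein's inequality for the deviation of an empirical mean from the expectation. -/
theorem bernstein_norm_mean_sub {X V : Type*} [MeasurableSpace X] [NormedAddCommGroup V]
    [InnerProductSpace ℝ V] [CompleteSpace V] (ν : Measure X) [IsProbabilityMeasure ν] {g : X → V}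
    (hg : StronglyMeasurable g) {c σ L : ℝ} (hc : 0 < c) (hσ : 0 ≤ σ) (hL : 1 ≤ L)
    (hgc : ∀ x, ‖g x‖ ≤ c) (hv : ∫ x, ‖g x‖ ^ 2 ∂ν ≤ σ ^ 2) {n : ℕ} (hn : 1 ≤ n) :
    (Measure.pi fun _ : Fin n => ν).real
      {y | 2 * L * (2 * c / n + σ / √n) ≤ ‖(n : ℝ)⁻¹ • ∑ j, g (y j) - ∫ x, g x ∂ν‖} ≤
        2 * Real.exp (-L) := by
  have hn0 : (n : ℝ) ≠ 0 := by exact_mod_cast (by omega : n ≠ 0)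
  have hgi : Integrable g ν := Integrable.of_bound hg.aestronglyMeasurable c (ae_of_all _ hgc)
  have hg2 : Integrable (fun x => ‖g x‖ ^ 2) ν :=
    Integrable.of_bound (hg.norm.pow 2).aestronglyMeasurable (c ^ 2) (ae_of_all _ fun x => by
      rw [Real.norm_of_nonneg (by positivity)]
      gcongr
      exact hgc x)
  set m := ∫ x, g x ∂ν with hm
  have hmc : ‖m‖ ≤ c := by
    simpa using norm_integral_le_of_norm_le_const (μ := ν) (ae_of_all _ hgc)
  have h0 : ∫ x, (g x - m) ∂ν = 0 := by
    rw [integral_sub hgi (integrable_const m), ← hm]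
    simp
  have hvar : ∫ x, ‖g x - m‖ ^ 2 ∂ν ≤ σ ^ 2 := by
    have hi : Integrable (fun x => 2 * ⟪m, g x⟫_ℝ) ν := (hgi.const_inner m).const_mul 2
    have hi' : Integrable (fun x => ‖m‖ ^ 2 - 2 * ⟪m, g x⟫_ℝ) ν := (integrable_const _).sub hi
    have h : ∀ x, ‖g x - m‖ ^ 2 = ‖g x‖ ^ 2 + (‖m‖ ^ 2 - 2 * ⟪m, g x⟫_ℝ) := fun x => by
      rw [norm_sub_sq_real, real_inner_comm]
      ring
    simp only [h]
    rw [integral_add hg2 hi', integral_sub (integrable_const _) hi, integral_const_mul,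
      integral_inner hgi, ← hm, real_inner_self_eq_norm_sq]
    simp only [integral_const, probReal_univ, one_smul]
    nlinarith [sq_nonneg ‖m‖]
  -- Centering at most doubles the norm bound, hence `2 * c`, and does not increase the second
  -- moment.
  have h := bernstein_norm_mean ν (f := fun x => g x - m) (hg.sub stronglyMeasurable_const)
    (M := 2 * c) (by positivity) hσ hL
    (fun x => (norm_sub_le _ _).trans (by linarith [hgc x])) h0 hvar hn
  have hmean : ∀ y : Fin n → X,
      (n : ℝ)⁻¹ • ∑ j, (g (y j) - m) = (n : ℝ)⁻¹ • ∑ j, g (y j) - m := fun y => by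
    rw [Finset.sum_sub_distrib, smul_sub]
    simp [← Nat.cast_smul_eq_nsmul ℝ, smul_smul, hn0]
  simpa only [hmean] using h

theorem integrable_hsRankOne {ι X H : Type*} [NormedAddCommGroup H] [InnerProductSpace ℝ H]
    [MeasurableSpace X] (ν : Measure X) [IsProbabilityMeasure ν] {φ : X → H}
    (hφ : StronglyMeasurable φ) (hφ1 : ∀ x, ‖φ x‖ ≤ 1) (b : HilbertBasis ι ℝ H) (A : H →L[ℝ] H) :
    StronglyMeasurable (fun x => hsRankOne b (A (φ x)) (φ x)) ∧
      Integrable (fun x => hsRankOne b (A (φ x)) (φ x)) ν := by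
  have hc : Continuous fun v : H => hsRankOne b (A v) v :=
    ((hsRankOne b).continuous.comp A.continuous).clm_apply continuous_id
  have hs := hc.comp_stronglyMeasurable hφ
  refine ⟨hs, Integrable.of_bound hs.aestronglyMeasurable ‖A‖ (ae_of_all _ fun x => ?_)⟩
  refine (norm_hsRankOne_le b _ _).trans ?_
  exact (mul_le_of_le_one_right (norm_nonneg _) (hφ1 x)).trans (A.unit_le_opNorm _ (hφ1 x))

/-! ### Deviation of the empirical effective dimension -/

section Deviation

variable {X H : Type*} [NormedAddCommGroup H] [InnerProductSpace ℝ H] [CompleteSpace H]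
  [MeasurableSpace X] (ν : Measure X) [IsProbabilityMeasure ν] {φ : X → H} {lam : ℝ}

theorem summable_inner_empMoment {ι X H : Type*} [NormedAddCommGroup H] [InnerProductSpace ℝ H]
    (b : HilbertBasis ι ℝ H) (φ : X → H) {n : ℕ} (y : Fin n → X) : Summable fun i => ⟪b i, empMoment φ y (b i)⟫_ℝ := by
  simpa using (hasSum_inner_empMoment φ y b (A := 1) fun u v => by simp).summable

variable [TopologicalSpace.SeparableSpace H]

theorem hasSum_effDim_secondMoment (hφ : StronglyMeasurable φ) (hφ1 : ∀ x, ‖φ x‖ ≤ 1)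
    (hlam : 0 < lam) :
    HasSum (fun i => ⟪basis H i, resolventMul (secondMoment ν φ) lam (basis H i)⟫_ℝ)
      (∫ x, ⟪φ x, res (secondMoment ν φ) lam (φ x)⟫_ℝ ∂ν) := by
  have hT := isPositive_secondMoment ν hφ hφ1
  have : Countable (basisSet H) := countable_of_hilbertBasis (basis H)
  simp only [resolventMul_apply_comm hT hlam]
  exact hasSum_inner_secondMoment ν hφ hφ1 (basis H) (inner_res_comm hT hlam)

theorem effDim_secondMoment (hφ : StronglyMeasurable φ) (hφ1 : ∀ x, ‖φ x‖ ≤ 1)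
    (hlam : 0 < lam) :
    effDim (secondMoment ν φ) lam = ∫ x, ⟪φ x, res (secondMoment ν φ) lam (φ x)⟫_ℝ ∂ν :=
  (hasSum_effDim_secondMoment ν hφ hφ1 hlam).tsum_eq

/-- The difference of the effective dimensions is controlled by the deviations of two empirical
means: one real-valued, one in the space of Hilbert-Schmidt operators. -/
theorem abs_effDim_sub_effDim_le (hφ : StronglyMeasurable φ) (hφ1 : ∀ x, ‖φ x‖ ≤ 1)
    (hlam : 0 < lam) {n : ℕ} (y : Fin n → X) {R : H →L[ℝ] H}
    (hR : R = res (secondMoment ν φ) lam) :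
    |effDim (secondMoment ν φ) lam - effDim (empMoment φ y) lam| ≤
      ‖(n : ℝ)⁻¹ • ∑ j, ⟪φ (y j), R (φ (y j))⟫_ℝ - ∫ x, ⟪φ x, R (φ x)⟫_ℝ ∂ν‖ +
      ‖(n : ℝ)⁻¹ • ∑ j, hsRankOne (basis H) (R (φ (y j))) (φ (y j)) -
          ∫ x, hsRankOne (basis H) (R (φ x)) (φ x) ∂ν‖ * √(effDim (empMoment φ y) lam) := by
  have hT := isPositive_secondMoment ν hφ hφ1
  have hS := isPositive_empMoment φ y
  set T := secondMoment ν φ with hTdef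
  set S := empMoment φ y with hSdef
  set b := basis H with hb
  have hRs : ∀ u v, ⟪R u, v⟫_ℝ = ⟪u, R v⟫_ℝ := hR ▸ inner_res_comm hT hlam
  have hG : HasSum (fun i => ⟪b i, resolventMul S lam (b i)⟫_ℝ) (effDim S lam) :=
    (summable_inner_resolventMul b hS hlam (summable_inner_empMoment b φ y)).hasSum
  set d := (n : ℝ)⁻¹ • ∑ j, hsRankOne b (R (φ (y j))) (φ (y j)) -
    ∫ x, hsRankOne b (R (φ x)) (φ x) ∂ν with hd
  -- `d` is the operator `(S - T) R`, recorded by its values on the basis.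
  have hdi : ∀ i, d i = S (R (b i)) - T (R (b i)) := by
    intro i
    have h1 : (∫ x, hsRankOne b (R (φ x)) (φ x) ∂ν) i = T (R (b i)) := by
      change lp.evalCLM ℝ (fun _ => H) 2 i (∫ x, hsRankOne b (R (φ x)) (φ x) ∂ν) = _
      rw [← ContinuousLinearMap.integral_comp_comm _ (integrable_hsRankOne ν hφ hφ1 b R).2,
        hTdef, secondMoment_apply ν hφ hφ1]
      refine integral_congr_ae (ae_of_all _ fun x => ?_)
      change ⟪b i, R (φ x)⟫_ℝ • φ x = _
      rw [← hRs, real_inner_comm]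
    have h2 : ((n : ℝ)⁻¹ • ∑ j, hsRankOne b (R (φ (y j))) (φ (y j))) i = S (R (b i)) := by
      change lp.evalCLM ℝ (fun _ => H) 2 i
        ((n : ℝ)⁻¹ • ∑ j, hsRankOne b (R (φ (y j))) (φ (y j))) = _
      rw [map_smul, map_sum, hSdef, empMoment_apply]
      congr 1
      refine Finset.sum_congr rfl fun j _ => ?_
      change ⟪b i, R (φ (y j))⟫_ℝ • φ (y j) = _
      rw [← hRs, real_inner_comm]
    rw [← h1, ← h2]
    rfl
  have hGsq : Summable fun i => ‖resolventMul S lam (b i)‖ ^ 2 :=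
    Summable.of_nonneg_of_le (fun i => sq_nonneg _)
      (fun i => norm_resolventMul_sq_le hS hlam (b i)) hG.summable
  let g : lp (fun _ : basisSet H => H) 2 :=
    ⟨fun i => resolventMul S lam (b i), memℓp_two_of_summable_norm_sq hGsq⟩
  have hgn : ‖g‖ ≤ √(effDim S lam) := by
    refine Real.le_sqrt_of_sq_le ?_
    rw [norm_sq_eq_tsum]
    exact hasSum_le (fun i => norm_resolventMul_sq_le hS hlam (b i)) hGsq.hasSum hG
  have : Countable (basisSet H) := countable_of_hilbertBasis b
  have hN := hasSum_inner_secondMoment ν hφ hφ1 b hRs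
  have hM := hasSum_inner_empMoment φ y b hRs
  have hE := hasSum_effDim_secondMoment ν hφ hφ1 hlam
  -- The trace of the resolvent decomposition; moving the self-adjoint `resolventMul S lam` to the
  -- left factor makes its second term the Hilbert-Schmidt pairing of `g` and `d`.
  have key : effDim T lam - effDim S lam =
      (∫ x, ⟪φ x, R (φ x)⟫_ℝ ∂ν - (n : ℝ)⁻¹ • ∑ j, ⟪φ (y j), R (φ (y j))⟫_ℝ) + ⟪g, d⟫_ℝ := by
    rw [effDim_secondMoment ν hφ hφ1 hlam]
    refine (hE.sub hG).unique (((hN.sub hM).add (lp.hasSum_inner (𝕜 := ℝ) g d)).congr_fun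
      fun i => ?_)
    rw [← inner_sub_right, ← inner_sub_right, resolventMul_sub_resolventMul hT hS hlam, ← hR,
      inner_sub_right, ← inner_resolventMul_comm hS hlam, hdi, ← neg_sub (T (R (b i))),
      inner_neg_right, sub_eq_add_neg]
  rw [key]
  refine (abs_add_le _ _).trans (add_le_add ?_ ?_)
  · rw [← Real.norm_eq_abs, norm_sub_rev]
  · refine (abs_real_inner_le_norm g d).trans ?_
    rw [mul_comm]
    gcongr

/-- With high probability the effective dimensions are close. -/
theorem exists_event_abs_effDim_sub_le (hφ : StronglyMeasurable φ) (hφ1 : ∀ x, ‖φ x‖ ≤ 1)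
    (hlam : 0 < lam) {n : ℕ} (hn : 1 ≤ n) {L : ℝ} (hL : 1 ≤ L) :
    ∃ E : Set (Fin n → X), MeasurableSet E ∧
      1 - 4 * Real.exp (-L) ≤ (Measure.pi fun _ : Fin n => ν).real E ∧
      ∀ y ∈ E, |effDim (secondMoment ν φ) lam - effDim (empMoment φ y) lam| ≤
        2 * L * (2 * lam⁻¹ / n + √(effDim (secondMoment ν φ) lam / lam) / √n) *
          (1 + √(effDim (empMoment φ y) lam)) := by
  have hT := isPositive_secondMoment ν hφ hφ1
  have hNdef := effDim_secondMoment ν hφ hφ1 hlam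
  set N := effDim (secondMoment ν φ) lam with hN
  obtain ⟨R, hR⟩ : ∃ R, R = res (secondMoment ν φ) lam := ⟨_, rfl⟩
  rw [← hR] at hNdef
  have hRφ : StronglyMeasurable fun x => R (φ x) := R.continuous.comp_stronglyMeasurable hφ
  have hRn : ∀ x, ‖R (φ x)‖ ≤ lam⁻¹ := fun x => by
    rw [hR]
    refine (norm_res_le hT hlam (φ x)).trans ?_
    rw [div_eq_mul_inv]
    exact mul_le_of_le_one_left (by positivity) (hφ1 x)
  have hRpos : ∀ x, 0 ≤ ⟪φ x, R (φ x)⟫_ℝ := fun x => hR ▸ inner_res_nonneg hT hlam (φ x)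
  have hRsq : ∀ x, ‖R (φ x)‖ ^ 2 ≤ ⟪φ x, R (φ x)⟫_ℝ / lam := fun x => by
    rw [le_div_iff₀' hlam, hR]
    exact mul_norm_res_sq_le hT hlam (φ x)
  have hN0 : 0 ≤ N := hNdef ▸ integral_nonneg hRpos
  have hinner : ∀ x, ‖⟪φ x, R (φ x)⟫_ℝ‖ ≤ ‖R (φ x)‖ := fun x =>
    (norm_inner_le_norm _ _).trans (mul_le_of_le_one_left (norm_nonneg _) (hφ1 x))
  have hhs : ∀ x, ‖hsRankOne (basis H) (R (φ x)) (φ x)‖ ≤ ‖R (φ x)‖ := fun x =>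
    (norm_hsRankOne_le _ _ _).trans (mul_le_of_le_one_right (norm_nonneg _) (hφ1 x))
  have hsm1 : StronglyMeasurable fun x => ⟪φ x, R (φ x)⟫_ℝ := hφ.inner hRφ
  have hsm2 := (integrable_hsRankOne ν hφ hφ1 (basis H) R).1
  have hint : Integrable (fun x => ⟪φ x, R (φ x)⟫_ℝ / lam) ν :=
    (Integrable.of_bound hsm1.aestronglyMeasurable lam⁻¹
      (ae_of_all _ fun x => (hinner x).trans (hRn x))).div_const _
  -- `‖R φ‖² ≤ ⟪φ, R φ⟫ / lam`, whose mean is `N / lam`; this serves both the scalar and the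
  -- operator deviation.
  have hvar : ∀ {q : X → ℝ}, (∀ x, 0 ≤ q x) → (∀ x, q x ≤ ‖R (φ x)‖) →
      ∫ x, q x ^ 2 ∂ν ≤ √(N / lam) ^ 2 := by
    intro q hq0 hq
    rw [Real.sq_sqrt (by positivity), hNdef, ← integral_div]
    exact integral_mono_of_nonneg (ae_of_all _ fun x => sq_nonneg _) hint
      (ae_of_all _ fun x => (pow_le_pow_left₀ (hq0 x) (hq x) 2).trans (hRsq x))
  have hb1 := bernstein_norm_mean_sub ν hsm1 (c := lam⁻¹) (by positivity)
    (Real.sqrt_nonneg (N / lam)) hL (fun x => (hinner x).trans (hRn x))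
    (hvar (fun x => norm_nonneg _) hinner) hn
  have hb2 := bernstein_norm_mean_sub ν hsm2 (c := lam⁻¹) (by positivity)
    (Real.sqrt_nonneg (N / lam)) hL (fun x => (hhs x).trans (hRn x))
    (hvar (fun x => norm_nonneg _) hhs) hn
  set r := 2 * L * (2 * lam⁻¹ / n + √(N / lam) / √n) with hr
  set E₁ := {y : Fin n → X |
    r ≤ ‖(n : ℝ)⁻¹ • ∑ j, ⟪φ (y j), R (φ (y j))⟫_ℝ - ∫ x, ⟪φ x, R (φ x)⟫_ℝ ∂ν‖} with hE₁
  set E₂ := {y : Fin n → X |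
    r ≤ ‖(n : ℝ)⁻¹ • ∑ j, hsRankOne (basis H) (R (φ (y j))) (φ (y j)) -
      ∫ x, hsRankOne (basis H) (R (φ x)) (φ x) ∂ν‖} with hE₂
  have hm1 : MeasurableSet E₁ := measurableSet_le measurable_const
    (((stronglyMeasurable_sum_eval hsm1 n).const_smul (n : ℝ)⁻¹).sub
      stronglyMeasurable_const).norm.measurable
  have hm2 : MeasurableSet E₂ := measurableSet_le measurable_const
    (((stronglyMeasurable_sum_eval hsm2 n).const_smul (n : ℝ)⁻¹).sub
      stronglyMeasurable_const).norm.measurable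
  -- Union bound over two tails of probability at most `2 exp (-L)` each.
  refine ⟨(E₁ ∪ E₂)ᶜ, (hm1.union hm2).compl, ?_, fun y hy => ?_⟩
  · rw [probReal_compl_eq_one_sub (hm1.union hm2)]
    have := measureReal_union_le (μ := Measure.pi fun _ : Fin n => ν) E₁ E₂
    linarith
  · simp only [Set.compl_union, Set.mem_inter_iff, Set.mem_compl_iff, hE₁, hE₂,
      Set.mem_ofPred_eq, not_le] at hy
    have h1 := hy.1.le
    have h2 := hy.2.le
    refine (abs_effDim_sub_effDim_le ν hφ hφ1 hlam y hR).trans ?_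
    rw [mul_add, mul_one]
    gcongr

end Deviation

/-! ### From the deviation bound to the ratio bounds -/

section Comparison

/-- The hypothesis reads `a (a - 2δb) ≤ b² + 2δ²b`. If `a > (1 + 4δ) b`, the left side exceeds `(1 +
4δ)(1 + 2δ) b²`, which is too large since `b ≤ b²`. -/
theorem le_one_add_four_mul_of_sq_le {a b δ : ℝ} (hb : 1 ≤ b) (hδ : 0 ≤ δ)
    (h : a ^ 2 ≤ b ^ 2 + δ * (a + δ) * (2 * b)) : a ≤ (1 + 4 * δ) * b := by
  by_contra! hlt
  have h1 : (1 + 4 * δ) * b * ((1 + 2 * δ) * b) < a * (a - 2 * δ * b) :=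
    mul_lt_mul'' hlt (by linarith) (by positivity) (by positivity)
  have h2 : δ ^ 2 * b ≤ δ ^ 2 * b ^ 2 := by
    gcongr
    nlinarith
  have h3 : 0 ≤ δ * b ^ 2 := by positivity
  have h4 : 0 ≤ δ ^ 2 * b ^ 2 := by positivity
  linarith

/-- As `a ≥ 1`, the hypothesis gives `b² ≤ a² + q a b` with `q = 2δ(1 + δ)`, whence `b ≤ (1 + q) a`.
The two cases of the maximum are `δ ≤ 1` and `δ ≥ 1`. -/
theorem le_one_add_four_mul_max_of_sq_le {a b δ : ℝ} (ha : 1 ≤ a) (hδ : 0 ≤ δ)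
    (h : b ^ 2 ≤ a ^ 2 + δ * (a + δ) * (2 * b)) : b ≤ (1 + 4 * max (√δ) (δ ^ 2)) * a := by
  have hq : 2 * δ * (1 + δ) ≤ 4 * max (√δ) (δ ^ 2) := by
    rcases le_total δ 1 with h1 | h1
    · have : δ ≤ √δ := Real.le_sqrt_of_sq_le (by nlinarith)
      nlinarith [le_max_left (√δ) (δ ^ 2)]
    · nlinarith [le_max_right (√δ) (δ ^ 2)]
  refine le_trans ?_ (mul_le_mul_of_nonneg_right (add_le_add_right hq 1) (by linarith : 0 ≤ a))
  by_contra! hlt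
  set q := 2 * δ * (1 + δ) with hqd
  have hq0 : 0 ≤ q := by positivity
  have hb0 : 0 ≤ b := le_trans (by positivity) hlt.le
  have h1 : 2 * δ * (a + δ) * b ≤ a * q * b := by
    refine mul_le_mul_of_nonneg_right ?_ hb0
    rw [hqd]
    nlinarith [mul_nonneg (mul_nonneg hδ hδ) (sub_nonneg.2 ha)]
  have h2 : a < b - a * q := by linarith
  have h3 : a ≤ b := by nlinarith
  nlinarith [mul_pos (by linarith : 0 < b) (sub_pos.2 h2)]

theorem sqrt_max_comparison {N M δ : ℝ} (hδ : 0 ≤ δ)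
    (h : |N - M| ≤ δ * (√N + δ) * (1 + √M)) :
    √(max N 1) ≤ (1 + 4 * δ) * √(max M 1) ∧
      √(max M 1) ≤ (1 + 4 * max (√δ) (δ ^ 2)) * √(max N 1) ∧
      (δ ≤ 1 → 1 / 5 * √(max N 1) ≤ √(max M 1) ∧ √(max M 1) ≤ 5 * √(max N 1)) := by
  have ha : 1 ≤ √(max N 1) := Real.one_le_sqrt.2 (le_max_right _ _)
  have hb : 1 ≤ √(max M 1) := Real.one_le_sqrt.2 (le_max_right _ _)
  have hNa : √N ≤ √(max N 1) := Real.sqrt_le_sqrt (le_max_left _ _)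
  have hMb : √M ≤ √(max M 1) := Real.sqrt_le_sqrt (le_max_left _ _)
  have hsa : √(max N 1) ^ 2 = max N 1 := Real.sq_sqrt (zero_le_one.trans (le_max_right _ _))
  have hsb : √(max M 1) ^ 2 = max M 1 := Real.sq_sqrt (zero_le_one.trans (le_max_right _ _))
  -- Truncation at `1` is 1-Lipschitz, so the deviation bound passes to the maxima.
  have hmax : |max N 1 - max M 1| ≤ |N - M| := abs_max_sub_max_le_abs N M 1
  set a := √(max N 1)
  set b := √(max M 1)
  have hD : |N - M| ≤ δ * (a + δ) * (2 * b) := by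
    refine h.trans ?_
    have : 1 + √M ≤ 2 * b := by linarith
    gcongr
  rw [← hsa, ← hsb] at hmax
  obtain ⟨h1, h2⟩ := abs_le.1 (hmax.trans hD)
  have hA : a ≤ (1 + 4 * δ) * b := le_one_add_four_mul_of_sq_le hb hδ (by linarith)
  have hB : b ≤ (1 + 4 * max (√δ) (δ ^ 2)) * a :=
    le_one_add_four_mul_max_of_sq_le ha hδ (by linarith)
  refine ⟨hA, hB, fun hδ1 => ⟨by nlinarith, hB.trans ?_⟩⟩
  have : max (√δ) (δ ^ 2) ≤ 1 := max_le (Real.sqrt_le_one.2 hδ1) (pow_le_one₀ hδ hδ1)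
  nlinarith

end Comparison

/-! ### The normalized feature map -/

section ScaledKernel

variable {X H : Type*} [NormedAddCommGroup H] [InnerProductSpace ℝ H] [CompleteSpace H]
  [RKHS ℝ H X ℝ]

theorem rankOne_smul_kSec (κ : ℝ) (x : X) :
    InnerProductSpace.rankOne ℝ (κ⁻¹ • kSec H x) (κ⁻¹ • kSec H x) = (κ ^ 2)⁻¹ • kOp H x := by
  ext v : 1
  simp [InnerProductSpace.rankOne_apply, kOp, smul_smul]
  congr 1
  ring

theorem smul_covOp_eq_secondMoment [MeasurableSpace X] (ν : Measure X) (κ : ℝ) :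
    (κ ^ 2)⁻¹ • covOp H ν = secondMoment ν fun x => κ⁻¹ • kSec H x := by
  simp only [secondMoment, rankOne_smul_kSec, covOp, integral_smul]

theorem smul_empOp_eq_empMoment (κ : ℝ) {n : ℕ} (y : Fin n → X) :
    (κ ^ 2)⁻¹ • empOp H y = empMoment (fun x => κ⁻¹ • kSec H x) y := by
  simp only [empMoment, rankOne_smul_kSec, empOp, ← Finset.smul_sum]
  rw [smul_comm]

theorem norm_smul_kSec_le_one {κ : ℝ} (hκ : 0 < κ) {x : X} (hx : K H x x ≤ κ ^ 2) :
    ‖κ⁻¹ • kSec H x‖ ≤ 1 := by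
  rw [← norm_kSec_sq] at hx
  rw [norm_smul, Real.norm_of_nonneg (by positivity), inv_mul_le_iff₀ hκ, mul_one]
  exact le_of_sq_le_sq hx hκ.le

end ScaledKernel

end EffDim

theorem mainTheorem6
    {X : Type*} [MeasurableSpace X] [StandardBorelSpace X]
    (ν : Measure X) [IsProbabilityMeasure ν]
    {H : Type*} [NormedAddCommGroup H] [InnerProductSpace ℝ H] [CompleteSpace H]
    [TopologicalSpace.SeparableSpace H] [RKHS ℝ H X ℝ]
    (hK : Measurable fun p : X × X => EffDim.K H p.1 p.2)
    (κ : ℝ) (hκ : 0 < κ) (hKκ : ∀ x : X, EffDim.K H x x ≤ κ ^ 2)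
    {Ω : Type*} [MeasurableSpace Ω] (P : Measure Ω) [IsProbabilityMeasure P]
    (n : ℕ) (hn : 1 ≤ n) (x : Fin n → Ω → X)
    (hx : ∀ j, Measurable (x j)) (hlaw : ∀ j, P.map (x j) = ν) (hindep : iIndepFun x P)
    (lam : ℝ) (hlam : 0 < lam) (hlam1 : lam ≤ 1)
    (η : ℝ) (hη : 0 < η) (hη1 : η < 1)
    (δ : ℝ) (hδ : δ = 2 * Real.log (4 * η⁻¹) / √(n * lam)) :
    -- the inverses and the traces that define `N(lam)` and `N_x(lam)` exist
    (IsUnit ((κ ^ 2)⁻¹ • EffDim.covOp H ν + lam • (1 : H →L[ℝ] H)) ∧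
      EffDim.IsTraceClass (EffDim.resolventMul ((κ ^ 2)⁻¹ • EffDim.covOp H ν) lam)) ∧
    (∀ y : Fin n → X,
      IsUnit ((κ ^ 2)⁻¹ • EffDim.empOp H y + lam • (1 : H →L[ℝ] H)) ∧
      EffDim.IsTraceClass (EffDim.resolventMul ((κ ^ 2)⁻¹ • EffDim.empOp H y) lam)) ∧
    -- the bounds hold on an event of probability at least `1 - η`
    ∃ E : Set Ω, MeasurableSet E ∧ 1 - η ≤ P.real E ∧ ∀ ω ∈ E,
      √(max (EffDim.popDim H κ ν lam) 1)
          ≤ (1 + 4 * δ) * √(max (EffDim.empDim H κ (fun j => x j ω) lam) 1) ∧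
      √(max (EffDim.empDim H κ (fun j => x j ω) lam) 1)
          ≤ (1 + 4 * max (√δ) (δ ^ 2)) * √(max (EffDim.popDim H κ ν lam) 1) ∧
      (δ ≤ 1 →
        1 / 5 * √(max (EffDim.popDim H κ ν lam) 1)
            ≤ √(max (EffDim.empDim H κ (fun j => x j ω) lam) 1) ∧
        √(max (EffDim.empDim H κ (fun j => x j ω) lam) 1)
            ≤ 5 * √(max (EffDim.popDim H κ ν lam) 1)) := by
  have hφ : StronglyMeasurable fun y : X => κ⁻¹ • EffDim.kSec H y :=
    (EffDim.stronglyMeasurable_kSec hK).const_smul _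
  have hφ1 : ∀ y : X, ‖κ⁻¹ • EffDim.kSec H y‖ ≤ 1 := fun y =>
    EffDim.norm_smul_kSec_le_one hκ (hKκ y)
  have hT := EffDim.isPositive_secondMoment ν hφ hφ1
  simp only [EffDim.popDim, EffDim.empDim, EffDim.smul_covOp_eq_secondMoment,
    EffDim.smul_empOp_eq_empMoment]
  refine ⟨⟨EffDim.isUnit_add_smul_one hT hlam, EffDim.isTraceClass_resolventMul hT hlam
    fun w b => ?_⟩, fun y => ⟨EffDim.isUnit_add_smul_one (EffDim.isPositive_empMoment _ y) hlam,
    EffDim.isTraceClass_resolventMul (EffDim.isPositive_empMoment _ y) hlam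
      fun w b => EffDim.summable_inner_empMoment b _ y⟩, ?_⟩
  · have := EffDim.countable_of_hilbertBasis b
    simpa using (EffDim.hasSum_inner_secondMoment ν hφ hφ1 b (A := 1) fun u v => by simp).summable
  have hn0 : (0 : ℝ) < n := by exact_mod_cast hn
  -- Chosen so that `4 exp (-L) = η`; `L ≥ 1` because `4 > e`.
  set L := Real.log (4 * η⁻¹) with hLdef
  have h4η : 4 ≤ 4 * η⁻¹ := by linarith [(one_le_inv₀ hη).2 hη1.le]
  have hL : 1 ≤ L := by
    rw [hLdef, Real.le_log_iff_exp_le (by positivity)]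
    linarith [Real.exp_one_lt_d9]
  have hexp : 4 * Real.exp (-L) = η := by
    rw [hLdef, Real.exp_neg, Real.exp_log (by positivity)]
    field_simp
  obtain ⟨E, hE, hPE, hbound⟩ :=
    EffDim.exists_event_abs_effDim_sub_le ν hφ hφ1 hlam hn hL
  have hxm : Measurable fun ω j => x j ω := measurable_pi_lambda _ hx
  -- By independence the sample has law `ν^n`, so the event pulls back with the same probability.
  have hmap : P.map (fun ω j => x j ω) = Measure.pi fun _ : Fin n => ν := by
    rw [(iIndepFun_iff_map_fun_eq_pi_map fun j => (hx j).aemeasurable).1 hindep]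
    simp only [hlaw]
  refine ⟨(fun ω j => x j ω) ⁻¹' E, hxm hE, ?_, fun ω hω => ?_⟩
  · rw [← hexp, ← map_measureReal_apply hxm hE, hmap]
    exact hPE
  have hs : 0 < √(n * lam) := Real.sqrt_pos.2 (by positivity)
  have hδ0 : 0 ≤ δ := by rw [hδ]; positivity
  refine EffDim.sqrt_max_comparison hδ0 ((hbound _ hω).trans ?_)
  refine mul_le_mul_of_nonneg_right ?_ (by positivity)
  set N := EffDim.effDim (EffDim.secondMoment ν fun y : X => κ⁻¹ • EffDim.kSec H y) lam
  have h1 : √(N / lam) / √n = √N / √(n * lam) := by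
    rw [Real.sqrt_div' _ hlam.le, Real.sqrt_mul hn0.le, div_div, mul_comm (√lam)]
  have h2 : 2 * lam⁻¹ / n = 2 / √(n * lam) ^ 2 := by
    rw [Real.sq_sqrt (by positivity)]
    field_simp
  -- Since `L ≥ 1`, the range term of Bernstein's bound is absorbed into a second factor `δ`.
  have h3 : 2 / √(n * lam) ≤ δ := by
    rw [hδ]
    gcongr
    linarith
  calc 2 * L * (2 * lam⁻¹ / n + √(N / lam) / √n) = δ * (√N + 2 / √(n * lam)) := by
        rw [h1, h2, hδ]
        field_simp
        ring
    _ ≤ δ * (√N + δ) := by gcongr
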